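/- A compact metric graph $\Gamma$ consists of finite sets $\mathrm V(\Gamma)$ of vertices and $\mathrm E(\Gamma)$ of edges (loops and multiple edges allowed; we assume that there is at least one edge), in which each edge $e$ has a length $\ell_e\in(0,\infty)$ and is identified with the interval $[0,\ell_e]$, whose end points are the end vertices of $e$. Let $\ell(\Gamma)=\sum_{e}\ell_e$, and for a function $u=(u_e)_{e}$ on $\Gamma$ write $\int_\Gamma u\,dx=\sum_e\int_0^{\ell_e}u_e(x)\,dx$. For $1<p<\infty$, $W^{1,p}(\Gamma)$ is the space of continuous functions $u$ on $\Gamma$ with $u_e\in W^{1,p}(0,\ell_e)$ for every edge $e$. For a non-empty set $\mathrm V_D\subseteq \mathrm V(\Gamma)$ put $$\lambda_{1,p}(\Gamma,\mathrm V_D)=\inf\left\{\frac{\int_\Gamma|u'|^p\,dx}{\int_\Gamma|u|^p\,dx}\;:\;u\in W^{1,p}(\Gamma),\ u=0\text{ on }\mathrm V_D,\ u\neq0\right\},$$ which is the first eigenvalue of the $p$-Laplacian with Dirichlet conditions on $\mathrm V_D$ and Kirchhoff conditions at the other vertices. Let $$\pi_p=\frac{2\pi}{p\sin(\pi/p)},\qquad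 \frac1p+\frac1{p'}=1 .$$ **Theorem.** Let $1<p<\infty$. For every connected compact metric graph $\Gamma$ and every non-empty $\mathrm V_D\subseteq\mathrm V(\Gamma)$, $$\lambda_{1,p}(\Gamma,\mathrm V_D)\;\ge\;\left(\frac{\pi_p}{2\ell(\Gamma)}\right)^p\frac{p}{p'} .$$ The bound is sharp: for every $L>0$, if $\Gamma$ is the graph with two vertices $v_1,v_2$ and a single edge of length $L$ joining them (so that $\ell(\Gamma)=L$), then $$\lambda_{1,p}(\Gamma,\{v_1\})=\left(\frac{\pi_p}{2L}\right)^p\frac{p}{p'} .$$ -/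

import Mathlib

open MeasureTheory Set
open scoped ContDiff

/-- The number `π_p = 2π / (p sin (π / p))`. -/
noncomputable def piP (p : ℝ) : ℝ := 2 * Real.pi / (p * Real.sin (Real.pi / p))

/-- `g` is a weak derivative of `u` on the open interval `(a, b)`. Local integrability of `u` and
`g` is imposed separately, where this is used. -/
def HasWeakDerivOn (a b : ℝ) (u g : ℝ → ℝ) : Prop :=
  ∀ φ : ℝ → ℝ, ContDiff ℝ ∞ φ → HasCompactSupport φ → tsupport φ ⊆ Ioo a b →
    ∫ x in Ioo a b, u x * deriv φ x = -∫ x in Ioo a b, g x * φ x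

/-- A metric graph with vertices `V` and edges `E`, all of whose edges have finite length. Every
edge carries a direction, and is identified with the interval `[0, length e]` so that `0` is its
initial vertex `src e` and `length e` is its terminal vertex `tgt e`. Loops and multiple edges are
allowed. The graph is compact when `V` and `E` are finite. -/
structure MetricGraph (V E : Type*) where
  src : E → V
  tgt : E → V
  length : E → ℝ
  length_pos : ∀ e, 0 < length e

/-- A function on a graph: its values at the vertices and, for each edge, a function of the
coordinate of this edge (only the coordinates in `[0, length e]` matter). -/
structure GraphFunction (V E : Type*) where
  onVertex : V → ℝ
  onEdge : E → ℝ → ℝ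

namespace MetricGraph

variable {V E : Type*} (Γ : MetricGraph V E)

/-- Two vertices are adjacent when an edge connects them. -/
def Adj (v w : V) : Prop :=
  ∃ e, (Γ.src e = v ∧ Γ.tgt e = w) ∨ (Γ.src e = w ∧ Γ.tgt e = v)

/-- Any two vertices are joined by a walk. -/
def Connected : Prop :=
  Nonempty V ∧ ∀ v w : V, Relation.ReflTransGen Γ.Adj v w

/-- The total length of the graph. -/
noncomputable def totalLength [Fintype E] : ℝ := ∑ e, Γ.length e

/-- Continuity on the graph: continuity along each closed edge, and the functions on all edges
incident to a vertex assume the same value there, the value at the vertex. -/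
structure IsContinuous (u : GraphFunction V E) : Prop where
  continuousOn : ∀ e, ContinuousOn (u.onEdge e) (Icc 0 (Γ.length e))
  src_eq : ∀ e, u.onEdge e 0 = u.onVertex (Γ.src e)
  tgt_eq : ∀ e, u.onEdge e (Γ.length e) = u.onVertex (Γ.tgt e)

/-- `u` belongs to the Sobolev space `W^{1,p}` of the graph, and its derivative is `du`. -/
structure IsSobolev (p : ℝ) (u : GraphFunction V E) (du : E → ℝ → ℝ) : Prop where
  isContinuous : Γ.IsContinuous u
  memLp : ∀ e, MemLp (u.onEdge e) (ENNReal.ofReal p) (volume.restrict (Ioo 0 (Γ.length e)))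
  memLp_deriv : ∀ e, MemLp (du e) (ENNReal.ofReal p) (volume.restrict (Ioo 0 (Γ.length e)))
  hasWeakDeriv : ∀ e, HasWeakDerivOn 0 (Γ.length e) (u.onEdge e) (du e)

/-- `u` is not the zero function. -/
def IsNonzero (u : GraphFunction V E) : Prop :=
  ∃ e, ∃ x ∈ Icc 0 (Γ.length e), u.onEdge e x ≠ 0

/-- The integral over the graph of `|f|^p`. -/
noncomputable def integralAbsPow [Fintype E] (p : ℝ) (f : E → ℝ → ℝ) : ℝ :=
  ∑ e, ∫ x in Ioo 0 (Γ.length e), |f e x| ^ p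

/-- The Rayleigh quotients of the nonzero functions in `W^{1,p}` that vanish on `VD`. -/
def rayleighQuotients [Fintype E] (p : ℝ) (VD : Set V) : Set ℝ :=
  {r | ∃ (u : GraphFunction V E) (du : E → ℝ → ℝ), Γ.IsSobolev p u du ∧
    (∀ v ∈ VD, u.onVertex v = 0) ∧ Γ.IsNonzero u ∧
    r = Γ.integralAbsPow p du / Γ.integralAbsPow p u.onEdge}

/-- The first eigenvalue `λ_{1,p}` of the `p`-Laplacian, with Dirichlet conditions on `VD` and
Kirchhoff conditions at the other vertices. -/
noncomputable def firstEigenvalue [Fintype E] (p : ℝ) (VD : Set V) : ℝ :=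
  sInf (Γ.rayleighQuotients p VD)

/-- The graph with two vertices and one edge of length `L` from the first to the second. -/
def segment (L : ℝ) (hL : 0 < L) : MetricGraph (Fin 2) Unit where
  src _ := 0
  tgt _ := 1
  length _ := L
  length_pos _ := hL

end MetricGraph

/-! The lower bound comes from Picone's inequality, integrated along a closed walk. Write q = p'. If
h' = -l - (p-1)|h|^q on an interval, Young's inequality gives (h|u|^p)' ≤ |u'|^p - l|u|^p for every
Sobolev function u (`picone_pointwise`, `riccati_boundary_le`). A connected graph has a closed walk
from a Dirichlet vertex v through every edge exactly twice (`Connected.exists_isDoubleTour`). Let h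
run along this walk, whose length is 2ℓ(Γ). As u(v) = 0, the boundary terms vanish and 0 ≤ 2(∫|u'|^p
- l∫|u|^p). Neither rearrangement nor existence of an eigenfunction is needed.

It remains to see for which l some h exists on an interval of length 2ℓ(Γ). Rescaled generalized
tangents, τ' = 1 + |τ|^q, are solutions. They live on (-A, A), where A = ∫_0^∞ ds/(1+s^q) = π/(q
sin(π/q)) = (p-1)π_p/2. So l = κ^p/(p-1)^(p-1) is allowed whenever κℓ(Γ) < A
(`exists_riccati_solution`), and κ → A/ℓ(Γ) gives the bound.

For sharpness, (1+|τ|^q)^(-1/p) falls from 1 at 0 to 0 at A; reflected and rescaled to the segment,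
it attains the bound (`exists_generalized_sine`). -/

/-! ### Absolute continuity and Picone's inequality on an interval. -/

theorem AbsolutelyContinuousOnInterval.congr {f g : ℝ → ℝ} {a b : ℝ}
    (hf : AbsolutelyContinuousOnInterval f a b) (h : EqOn f g (uIcc a b)) :
    AbsolutelyContinuousOnInterval g a b := by
  rw [absolutelyContinuousOnInterval_iff] at hf ⊢
  intro ε hε
  obtain ⟨δ, hδ, H⟩ := hf ε hε
  refine ⟨δ, hδ, fun E hE hlt => ?_⟩
  refine lt_of_eq_of_lt (Finset.sum_congr rfl fun i hi => ?_) (H E hE hlt)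
  rw [h (hE.1 i hi).1, h (hE.1 i hi).2]

theorem LipschitzOnWith.comp_absolutelyContinuousOnInterval {f u : ℝ → ℝ} {a b : ℝ} {s : Set ℝ}
    {K : NNReal} (hf : LipschitzOnWith K f s) (hu : AbsolutelyContinuousOnInterval u a b)
    (hs : MapsTo u (uIcc a b) s) :
    AbsolutelyContinuousOnInterval (fun x => f (u x)) a b := by
  rw [absolutelyContinuousOnInterval_iff] at hu ⊢
  intro ε hε
  obtain ⟨δ, hδ, H⟩ := hu (ε / (K + 1)) (by positivity)
  refine ⟨δ, hδ, fun E hE hlt => ?_⟩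
  calc ∑ i ∈ Finset.range E.1, dist (f (u (E.2 i).1)) (f (u (E.2 i).2))
      ≤ ∑ i ∈ Finset.range E.1, K * dist (u (E.2 i).1) (u (E.2 i).2) :=
        Finset.sum_le_sum fun i hi =>
          hf.dist_le_mul _ (hs (hE.1 i hi).1) _ (hs (hE.1 i hi).2)
    _ = K * ∑ i ∈ Finset.range E.1, dist (u (E.2 i).1) (u (E.2 i).2) :=
        (Finset.mul_sum _ _ _).symm
    _ ≤ K * (ε / (K + 1)) := by gcongr; exact (H E hE hlt).le
    _ < (K + 1) * (ε / (K + 1)) := by gcongr; linarith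
    _ = ε := by field

theorem AbsolutelyContinuousOnInterval.abs_rpow {u : ℝ → ℝ} {a b p : ℝ} (hp : 1 < p)
    (hu : AbsolutelyContinuousOnInterval u a b) :
    AbsolutelyContinuousOnInterval (fun x => |u x| ^ p) a b := by
  obtain ⟨C, hC⟩ := hu.exists_bound
  have hcd : ContDiff ℝ 1 (fun y : ℝ => |y| ^ p) := by
    simpa using contDiff_norm_rpow (E := ℝ) hp
  obtain ⟨K, hK⟩ := hcd.contDiffOn.exists_lipschitzOnWith (s := Icc (-C) C) (by decide)
    (convex_Icc _ _) isCompact_Icc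
  refine hK.comp_absolutelyContinuousOnInterval hu fun x hx => ?_
  exact abs_le.1 (hC x hx)

/-- This is p times Young's inequality for g and h|u|^(p-2)u, with (p-1)q = p and p/q = p-1. The
left side is the derivative of h|u|^p when h solves the Riccati equation and u' = g. -/
theorem picone_pointwise {p q : ℝ} (hpq : p.HolderConjugate q) (h u g l : ℝ) :
    (-l - (p - 1) * |h| ^ q) * |u| ^ p + h * (p * |u| ^ (p - 2) * u * g) ≤
      |g| ^ p - l * |u| ^ p := by
  have hp := hpq.lt
  have hp0 : 0 < p := by linarith
  have hq0 : 0 < q := hpq.symm.pos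
  have h1 : |h * (|u| ^ (p - 2) * u)| ^ q = |h| ^ q * |u| ^ p := by
    rw [abs_mul, Real.mul_rpow (abs_nonneg _) (abs_nonneg _)]
    congr 1
    rcases eq_or_ne u 0 with rfl | hu
    · simp [hp0.ne', hq0.ne']
    · have hu' : 0 < |u| := abs_pos.2 hu
      rw [abs_mul, abs_of_nonneg (Real.rpow_nonneg (abs_nonneg u) _),
        ← Real.rpow_add_one hu'.ne', ← Real.rpow_mul hu'.le]
      congr 1
      have := hpq.sub_one_mul_conj
      linarith
  have h2 := Real.young_inequality g (h * (|u| ^ (p - 2) * u)) hpq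
  rw [h1] at h2
  have h3 : p / q = p - 1 := hpq.div_conj_eq_sub_one
  have h4 : p * (|g| ^ p / p + |h| ^ q * |u| ^ p / q) =
      |g| ^ p + (p - 1) * (|h| ^ q * |u| ^ p) := by
    rw [← h3]; field_simp
  nlinarith [mul_le_mul_of_nonneg_left h2 hp0.le]

/-- The product h|u|^p is absolutely continuous, so the pointwise inequality, known only almost
everywhere, may be integrated. -/
theorem riccati_boundary_le {p q l L : ℝ} (hpq : p.HolderConjugate q) (hL : 0 < L)
    {h u g : ℝ → ℝ}
    (hh : ∀ x ∈ Icc 0 L, HasDerivAt h (-l - (p - 1) * |h x| ^ q) x)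
    (hu : AbsolutelyContinuousOnInterval u 0 L)
    (hug : ∀ᵐ x, x ∈ Ioo 0 L → HasDerivAt u (g x) x)
    (hg : IntegrableOn (fun x => |g x| ^ p) (Ioo 0 L)) :
    h L * |u L| ^ p - h 0 * |u 0| ^ p ≤
      (∫ x in Ioo 0 L, |g x| ^ p) - l * ∫ x in Ioo 0 L, |u x| ^ p := by
  have hp := hpq.lt
  have hhc : ContinuousOn h (Icc 0 L) := fun x hx => (hh x hx).continuousAt.continuousWithinAt
  have hhac : AbsolutelyContinuousOnInterval h 0 L := by
    have hd : ContinuousOn (fun x => -l - (p - 1) * |h x| ^ q) (Icc 0 L) :=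
      continuousOn_const.sub (continuousOn_const.mul
        (hhc.abs.rpow_const fun x _ => Or.inr hpq.symm.nonneg))
    have hint : IntervalIntegrable (fun x => -l - (p - 1) * |h x| ^ q) volume 0 L :=
      ContinuousOn.intervalIntegrable (by rwa [uIcc_of_le hL.le])
    have h1 := hint.absolutelyContinuousOnInterval_intervalIntegral (c := 0) left_mem_uIcc
    have h2 : AbsolutelyContinuousOnInterval (fun _ : ℝ => h 0) 0 L :=
      (LipschitzWith.const (h 0)).lipschitzOnWith.absolutelyContinuousOnInterval
    refine (h2.add h1).congr fun x hx => ?_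
    rw [uIcc_of_le hL.le] at hx
    have h3 := intervalIntegral.integral_eq_sub_of_hasDerivAt (f := h) (a := 0) (b := x)
      (f' := fun x => -l - (p - 1) * |h x| ^ q)
      (fun y hy => hh y (by rw [uIcc_of_le hx.1] at hy; exact ⟨hy.1, hy.2.trans hx.2⟩))
      (hint.mono_set (by
        rw [uIcc_of_le hx.1, uIcc_of_le hL.le]; exact Icc_subset_Icc_right hx.2))
    simp [h3]
  have hF := hhac.fun_mul (hu.abs_rpow hp)
  have hup : IntegrableOn (fun x => |u x| ^ p) (Ioo 0 L) := by
    have : ContinuousOn (fun x => |u x| ^ p) (Icc 0 L) := by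
      simpa [uIcc_of_le hL.le] using (hu.abs_rpow hp).continuousOn
    exact (this.integrableOn_Icc).mono_set Ioo_subset_Icc_self
  have hdint : IntegrableOn (deriv fun x => h x * |u x| ^ p) (Ioo 0 L) := by
    have := hF.intervalIntegrable_deriv
    rw [intervalIntegrable_iff_integrableOn_Ioo_of_le hL.le] at this
    exact this
  have hFTC := hF.integral_deriv_eq_sub
  rw [intervalIntegral.integral_of_le hL.le, integral_Ioc_eq_integral_Ioo] at hFTC
  rw [← hFTC, ← integral_const_mul, ← integral_sub hg (hup.const_mul l)]
  refine integral_mono_ae hdint (hg.sub (hup.const_mul l)) ?_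
  refine (ae_restrict_iff' measurableSet_Ioo).2 ?_
  filter_upwards [hug] with x hx hxI
  have h1 := (hh x (Ioo_subset_Icc_self hxI)).mul
    ((hasDerivAt_abs_rpow (u x) hp).comp x (hx hxI))
  have h2 : deriv (fun x => h x * |u x| ^ p) x = _ := h1.deriv
  rw [h2]
  exact picone_pointwise hpq (h x) (u x) (g x) l

/-! ### From weak derivatives to absolute continuity. -/

theorem exists_testFunction_deriv_eq {L : ℝ} {ψ : ℝ → ℝ} (hψ : ContDiff ℝ ∞ ψ)
    (hc : HasCompactSupport ψ) (hs : tsupport ψ ⊆ Ioo 0 L) (h0 : ∫ x in Ioo 0 L, ψ x = 0) :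
    ∃ φ : ℝ → ℝ, ContDiff ℝ ∞ φ ∧ HasCompactSupport φ ∧ tsupport φ ⊆ Ioo 0 L ∧ deriv φ = ψ := by
  rcases (tsupport ψ).eq_empty_or_nonempty with he | hne
  · have hz : ψ = 0 := tsupport_eq_empty_iff.1 he
    refine ⟨0, contDiff_const, HasCompactSupport.zero, ?_, ?_⟩
    · rw [show tsupport (0 : ℝ → ℝ) = ∅ from tsupport_eq_empty_iff.2 rfl]
      exact empty_subset _
    · rw [hz]; ext x; simp
  obtain ⟨a, ha, ha'⟩ := hc.isCompact.exists_isLeast hne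
  obtain ⟨b, hb, hb'⟩ := hc.isCompact.exists_isGreatest hne
  have hz : ∀ x, x < a ∨ b < x → ψ x = 0 := fun x hx => by
    by_contra hne
    have hx' : x ∈ tsupport ψ := subset_tsupport _ hne
    rcases hx with hx | hx
    · exact absurd (ha' hx') (not_le.2 hx)
    · exact absurd (hb' hx') (not_le.2 hx)
  have hL : 0 < L := (hs ha).1.trans (hs ha).2
  have hψc := hψ.continuous
  have hd : ∀ x, HasDerivAt (fun x => ∫ y in (0 : ℝ)..x, ψ y) (ψ x) x := fun x =>
    intervalIntegral.integral_hasDerivAt_right (hψc.intervalIntegrable _ _)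
      (hψc.stronglyMeasurableAtFilter _ _) hψc.continuousAt
  have hderiv : deriv (fun x => ∫ y in (0 : ℝ)..x, ψ y) = ψ := funext fun x => (hd x).deriv
  have hsupp : Function.support (fun x => ∫ y in (0 : ℝ)..x, ψ y) ⊆ Icc a b := by
    intro x hx
    by_contra hxI
    refine hx ?_
    rcases lt_or_ge x a with hxa | hxa
    · refine intervalIntegral.integral_zero_ae (Filter.Eventually.of_forall fun y hy => ?_)
      exact hz y (Or.inl (by
        have := (uIoc_subset_uIcc hy).2
        exact this.trans_lt (max_lt (hs ha).1 hxa)))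
    · have hxb : b < x := by
        by_contra hxb
        exact hxI ⟨hxa, not_lt.1 hxb⟩
      change ∫ y in (0 : ℝ)..x, ψ y = 0
      rw [← intervalIntegral.integral_add_adjacent_intervals (b := L)
        (hψc.intervalIntegrable _ _) (hψc.intervalIntegrable _ _),
        intervalIntegral.integral_of_le hL.le, integral_Ioc_eq_integral_Ioo, h0, zero_add]
      refine intervalIntegral.integral_zero_ae (Filter.Eventually.of_forall fun y hy => ?_)
      exact hz y (Or.inr ((lt_min (hs hb).2 hxb).trans_le (uIoc_subset_uIcc hy).1))
  have htsupp := closure_minimal hsupp isClosed_Icc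
  refine ⟨_, contDiff_infty_iff_deriv.2 ⟨fun x => (hd x).differentiableAt, by rwa [hderiv]⟩,
    HasCompactSupport.of_support_subset_isCompact isCompact_Icc hsupp,
    htsupp.trans fun x hx => ⟨(hs ha).1.trans_le hx.1, hx.2.trans_lt (hs hb).2⟩, hderiv⟩

theorem exists_testFunction_integral_eq_one {L : ℝ} (hL : 0 < L) :
    ∃ ρ : ℝ → ℝ, ContDiff ℝ ∞ ρ ∧ HasCompactSupport ρ ∧ tsupport ρ ⊆ Ioo 0 L ∧
      ∫ x, ρ x = 1 := by
  let B : ContDiffBump (L / 2) := ⟨L / 8, L / 4, by positivity, by linarith⟩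
  refine ⟨B.normed volume, B.contDiff_normed, B.hasCompactSupport_normed, ?_, B.integral_normed⟩
  rw [B.tsupport_normed_eq, Real.closedBall_eq_Icc]
  exact fun x hx => ⟨by have := hx.1; simp only [B] at this; linarith,
    by have := hx.2; simp only [B] at this; linarith⟩

theorem setIntegral_eq_integral_of_tsupport_subset {s : Set ℝ} {f φ : ℝ → ℝ}
    (hs : tsupport φ ⊆ s) : ∫ x in s, f x * φ x = ∫ x, f x * φ x :=
  setIntegral_eq_integral_of_forall_compl_eq_zero fun x hx => by
    rw [image_eq_zero_of_notMem_tsupport fun h => hx (hs h), mul_zero]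

/-- The du Bois-Reymond lemma: subtracting from a test function its mean times a fixed bump ρ leaves
the derivative of a test function, so w - ∫wρ is orthogonal to all test functions. -/
theorem eqOn_const_of_integral_mul_deriv_eq_zero {L : ℝ} (hL : 0 < L) {w : ℝ → ℝ}
    (hw : ContinuousOn w (Icc 0 L))
    (h : ∀ φ : ℝ → ℝ, ContDiff ℝ ∞ φ → HasCompactSupport φ → tsupport φ ⊆ Ioo 0 L →
      ∫ x in Ioo 0 L, w x * deriv φ x = 0) :
    ∃ c, EqOn w (fun _ => c) (Icc 0 L) := by
  obtain ⟨ρ, hρ, hρc, hρs, hρ1⟩ := exists_testFunction_integral_eq_one hL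
  have hwi : ∀ ψ : ℝ → ℝ, Continuous ψ → IntegrableOn (fun x => w x * ψ x) (Ioo 0 L) :=
    fun ψ hψ => ((hw.mul hψ.continuousOn).integrableOn_Icc).mono_set Ioo_subset_Icc_self
  have hi : ∀ ψ : ℝ → ℝ, Continuous ψ → IntegrableOn ψ (Ioo 0 L) := fun ψ hψ =>
    (hψ.continuousOn.integrableOn_Icc).mono_set Ioo_subset_Icc_self
  have hset : ∀ ψ : ℝ → ℝ, tsupport ψ ⊆ Ioo 0 L → ∫ x in Ioo 0 L, ψ x = ∫ x, ψ x :=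
    fun ψ hψ => by
      simpa using setIntegral_eq_integral_of_tsupport_subset (f := fun _ => 1) hψ
  set c := ∫ x in Ioo 0 L, w x * ρ x with hc
  have key : ∀ᵐ x, x ∈ Ioo 0 L → w x - c = 0 := by
    refine isOpen_Ioo.ae_eq_zero_of_integral_contDiff_smul_eq_zero
      (f := fun x => w x - c) ?_ fun ψ hψ hψc hψs => ?_
    · exact ((hw.sub continuousOn_const).mono
        Ioo_subset_Icc_self).locallyIntegrableOn measurableSet_Ioo
    · set m := ∫ x, ψ x with hm
      have hts : tsupport (fun x => ψ x - m * ρ x) ⊆ Ioo 0 L :=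
        (tsupport_sub ψ (fun x => m * ρ x)).trans (union_subset hψs
          ((tsupport_mul_subset_right (f := fun _ => m) (g := ρ)).trans hρs))
      have hcs : HasCompactSupport (fun x => ψ x - m * ρ x) :=
        hψc.sub (hρc.mul_left (f := fun _ => m))
      obtain ⟨φ, h1, h2, h3, h4⟩ := exists_testFunction_deriv_eq (ψ := fun x => ψ x - m * ρ x)
        (hψ.sub (contDiff_const.mul hρ)) hcs hts (by
          rw [integral_sub (hi _ hψ.continuous) ((hi _ hρ.continuous).const_mul m),
            integral_const_mul, hset ρ hρs, hset ψ hψs, hρ1]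
          simp [hm])
      have h5 := h φ h1 h2 h3
      rw [h4] at h5
      have h6 : ∫ x in Ioo 0 L, w x * (ψ x - m * ρ x) =
          (∫ x in Ioo 0 L, w x * ψ x) - m * c := by
        rw [hc, ← integral_const_mul, ← integral_sub (hwi _ hψ.continuous)
          ((hwi _ hρ.continuous).const_mul m)]
        exact integral_congr_ae (Filter.Eventually.of_forall fun x => by simp only; ring)
      rw [h6] at h5
      calc ∫ x, ψ x • (w x - c) = ∫ x, (w x - c) * ψ x := by simp only [smul_eq_mul, mul_comm]
        _ = ∫ x in Ioo 0 L, (w x - c) * ψ x :=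
          (setIntegral_eq_integral_of_tsupport_subset hψs).symm
        _ = (∫ x in Ioo 0 L, w x * ψ x) - c * ∫ x in Ioo 0 L, ψ x := by
          rw [← integral_const_mul, ← integral_sub (hwi _ hψ.continuous)
            ((hi _ hψ.continuous).const_mul c)]
          exact integral_congr_ae (Filter.Eventually.of_forall fun x => by simp only; ring)
        _ = 0 := by rw [hset ψ hψs, ← hm]; linarith
  refine ⟨c, Measure.eqOn_Icc_of_ae_eq (μ := volume) hL.ne ?_ hw continuousOn_const⟩
  rw [Measure.restrict_congr_set Ioo_ae_eq_Icc.symm]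
  refine (ae_restrict_iff' measurableSet_Ioo).2 ?_
  filter_upwards [key] with x hx hxI
  linarith [hx hxI]

/-- The difference of u and the primitive of g has weak derivative zero, hence is constant. -/
theorem HasWeakDerivOn.absolutelyContinuousOnInterval {L : ℝ} (hL : 0 < L) {u g : ℝ → ℝ}
    (h : HasWeakDerivOn 0 L u g) (hu : ContinuousOn u (Icc 0 L)) (hg : IntegrableOn g (Ioo 0 L)) :
    AbsolutelyContinuousOnInterval u 0 L ∧ ∀ᵐ x, x ∈ Ioo 0 L → HasDerivAt u (g x) x := by
  have hgi : IntervalIntegrable g volume 0 L :=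
    (intervalIntegrable_iff_integrableOn_Ioo_of_le hL.le).2 hg
  set G : ℝ → ℝ := fun x => ∫ y in (0 : ℝ)..x, g y with hG
  have hGac : AbsolutelyContinuousOnInterval G 0 L :=
    hgi.absolutelyContinuousOnInterval_intervalIntegral left_mem_uIcc
  have hGc : ContinuousOn G (Icc 0 L) := by simpa [uIcc_of_le hL.le] using hGac.continuousOn
  have hGd : ∀ᵐ x, x ∈ Icc 0 L → HasDerivAt G (g x) x := by
    filter_upwards [hgi.ae_hasDerivAt_integral] with x hx hxI
    exact hx (by rwa [uIcc_of_le hL.le]) 0 left_mem_uIcc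
  obtain ⟨c, hc⟩ := eqOn_const_of_integral_mul_deriv_eq_zero hL (hu.sub hGc) fun φ h1 h2 h3 => by
    have hφac : AbsolutelyContinuousOnInterval φ 0 L :=
      (h1.of_le (by exact_mod_cast le_top)).contDiffOn.absolutelyContinuousOnInterval
    have hφ' : Continuous (deriv φ) := h1.continuous_deriv (by simp)
    have hφz : ∀ x, x ∉ Ioo 0 L → φ x = 0 := fun x hx =>
      image_eq_zero_of_notMem_tsupport fun hh => hx (h3 hh)
    have h4 := hGac.integral_mul_deriv_eq_deriv_mul hφac
    rw [hφz L (by simp), hφz 0 (by simp)] at h4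
    have h5 : ∫ x in (0 : ℝ)..L, deriv G x * φ x = ∫ x in (0 : ℝ)..L, g x * φ x := by
      refine intervalIntegral.integral_congr_ae ?_
      filter_upwards [hGd] with x hx hxI
      rw [(hx (by rw [← uIcc_of_le hL.le]; exact uIoc_subset_uIcc hxI)).deriv]
    rw [h5] at h4
    simp only [intervalIntegral.integral_of_le hL.le, integral_Ioc_eq_integral_Ioo] at h4
    have h6 := h φ h1 h2 h3
    have hi : ∀ w : ℝ → ℝ, ContinuousOn w (Icc 0 L) →
        IntegrableOn (fun x => w x * deriv φ x) (Ioo 0 L) := fun w hw =>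
      ((hw.mul hφ'.continuousOn).integrableOn_Icc).mono_set Ioo_subset_Icc_self
    simp only [Pi.sub_apply, sub_mul]
    rw [integral_sub (hi u hu) (hi G hGc), h6, h4]
    ring
  have hcG : EqOn u (fun x => c + G x) (Icc 0 L) := fun x hx => by
    have := hc hx
    simp only [Pi.sub_apply] at this
    linarith
  constructor
  · have h2 : AbsolutelyContinuousOnInterval (fun _ : ℝ => c) 0 L :=
      (LipschitzWith.const c).lipschitzOnWith.absolutelyContinuousOnInterval
    exact (h2.add hGac).congr fun x hx => (hcG (by rwa [uIcc_of_le hL.le] at hx)).symm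
  · filter_upwards [hGd] with x hx hxI
    refine ((hx (Ioo_subset_Icc_self hxI)).const_add c).congr_of_eventuallyEq ?_
    filter_upwards [isOpen_Ioo.mem_nhds hxI] with y hy using hcG (Ioo_subset_Icc_self hy)

/-! ### The generalized tangent and the Riccati equation. -/

/-- Write 1/(1+s^q) as ∫ exp(-(1+s^q)r) dr and swap by Tonelli: the result is Γ(1+1/q)Γ(1-1/q),
evaluated by the reflection formula. -/
theorem lintegral_inv_one_add_rpow {q : ℝ} (hq : 1 < q) :
    ∫⁻ s in Ioi (0 : ℝ), ENNReal.ofReal ((1 + s ^ q)⁻¹) =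
      ENNReal.ofReal (Real.pi / (q * Real.sin (Real.pi / q))) := by
  have hq0 : 0 < q := by linarith
  have hq1 : 1 / q < 1 := by rw [div_lt_one hq0]; exact hq
  have h1 : ∀ s ∈ Ioi (0 : ℝ), ENNReal.ofReal ((1 + s ^ q)⁻¹) =
      ∫⁻ r in Ioi (0 : ℝ), ENNReal.ofReal (Real.exp (-(1 + s ^ q) * r)) := fun s hs => by
    have hpos : 0 < 1 + s ^ q := by have := Real.rpow_pos_of_pos (mem_Ioi.1 hs) q; linarith
    rw [← ofReal_integral_eq_lintegral_ofReal
      (integrableOn_exp_mul_Ioi (by linarith) 0)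
      (Filter.Eventually.of_forall fun r => (Real.exp_pos _).le),
      integral_exp_mul_Ioi (by linarith), mul_zero, Real.exp_zero, neg_div_neg_eq, one_div]
  have h2 : ∀ r ∈ Ioi (0 : ℝ), ∫⁻ s in Ioi (0 : ℝ), ENNReal.ofReal (Real.exp (-(1 + s ^ q) * r)) =
      ENNReal.ofReal (Real.Gamma (1 / q + 1)) *
        ENNReal.ofReal (Real.exp (-r) * r ^ ((1 - 1 / q) - 1)) := fun r hr => by
    have hr : 0 < r := hr
    have hi : IntegrableOn (fun s : ℝ => Real.exp (-r) * Real.exp (-r * s ^ q)) (Ioi 0) := by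
      have := integrableOn_rpow_mul_exp_neg_mul_rpow (p := q) (s := 0) (by norm_num) hq0 hr
      simp only [Real.rpow_zero, one_mul] at this
      exact this.const_mul _
    have he : ∀ s : ℝ, Real.exp (-(1 + s ^ q) * r) =
        Real.exp (-r) * Real.exp (-r * s ^ q) := fun s => by
      rw [← Real.exp_add]; congr 1; ring
    simp only [he]
    rw [← ofReal_integral_eq_lintegral_ofReal hi
      (Filter.Eventually.of_forall fun r => by positivity), integral_const_mul,
      integral_exp_neg_mul_rpow hq0 hr, ← ENNReal.ofReal_mul
        (Real.Gamma_pos_of_pos (by positivity)).le]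
    congr 1
    rw [show (1 - 1 / q) - 1 = -1 / q by ring]
    ring
  rw [setLIntegral_congr_fun measurableSet_Ioi h1, lintegral_lintegral_swap,
    setLIntegral_congr_fun measurableSet_Ioi h2, lintegral_const_mul',
    ← ofReal_integral_eq_lintegral_ofReal (Real.GammaIntegral_convergent (by linarith)),
    ← Real.Gamma_eq_integral (by linarith), ← ENNReal.ofReal_mul
        (Real.Gamma_pos_of_pos (by positivity)).le]
  · congr 1
    rw [Real.Gamma_add_one (by positivity), mul_assoc, Real.Gamma_mul_Gamma_one_sub,
      mul_one_div, one_div, inv_mul_eq_div, div_div, mul_comm q]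
  · refine (ae_restrict_iff' measurableSet_Ioi).2 (Filter.Eventually.of_forall fun r hr => ?_)
    exact mul_nonneg (Real.exp_pos _).le (Real.rpow_nonneg (mem_Ioi.1 hr).le _)
  · exact ENNReal.ofReal_ne_top
  · refine Measurable.aemeasurable ?_
    simp only [Function.uncurry_def]
    fun_prop

theorem sin_pi_div_pos {q : ℝ} (hq : 1 < q) : 0 < Real.sin (Real.pi / q) :=
  Real.sin_pos_of_pos_of_lt_pi (by positivity) (div_lt_self Real.pi_pos hq)

theorem integrableOn_inv_one_add_rpow {q : ℝ} (hq : 1 < q) :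
    IntegrableOn (fun s : ℝ => (1 + |s| ^ q)⁻¹) (Ioi 0) ∧
      ∫ s in Ioi (0 : ℝ), (1 + |s| ^ q)⁻¹ = Real.pi / (q * Real.sin (Real.pi / q)) := by
  have h0 : ∫⁻ s in Ioi (0 : ℝ), ENNReal.ofReal ((1 + |s| ^ q)⁻¹) =
      ENNReal.ofReal (Real.pi / (q * Real.sin (Real.pi / q))) := by
    rw [← lintegral_inv_one_add_rpow hq]
    exact setLIntegral_congr_fun measurableSet_Ioi fun s hs => by
      simp only [abs_of_pos (mem_Ioi.1 hs)]
  have hpos : 0 ≤ᵐ[volume.restrict (Ioi (0 : ℝ))] fun s : ℝ => (1 + |s| ^ q)⁻¹ :=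
    Filter.Eventually.of_forall fun s => by positivity
  have hm : Measurable fun s : ℝ => (1 + |s| ^ q)⁻¹ := by fun_prop
  have hs := sin_pi_div_pos hq
  refine ⟨(lintegral_ofReal_ne_top_iff_integrable hm.aestronglyMeasurable hpos).1
    (by rw [h0]; exact ENNReal.ofReal_ne_top), ?_⟩
  rw [integral_eq_lintegral_of_nonneg_ae hpos hm.aestronglyMeasurable, h0,
    ENNReal.toReal_ofReal (by positivity)]

/-- The generalized tangent function, the solution of `τ' = 1 + |τ| ^ q` with `τ 0 = 0`. -/
theorem exists_generalized_tan {q A : ℝ} (hq : 1 < q)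
    (hA : A = Real.pi / (q * Real.sin (Real.pi / q))) :
    ∃ τ : ℝ → ℝ, (∀ t ∈ Ioo (-A) A, HasDerivAt τ (1 + |τ t| ^ q) t) ∧ τ 0 = 0 ∧
      Filter.Tendsto τ (nhdsWithin A (Iio A)) Filter.atTop := by
  obtain ⟨hint, hval⟩ := integrableOn_inv_one_add_rpow hq
  have hcont : Continuous fun s : ℝ => (1 + |s| ^ q)⁻¹ := by
    refine Continuous.inv₀ (continuous_const.add
      (continuous_abs.rpow_const fun x => Or.inr (by linarith))) fun s => ?_
    positivity
  -- The tangent is the inverse of this odd, strictly increasing function, whose limit at infinity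
  -- is A.
  set G : ℝ → ℝ := fun y => ∫ s in (0 : ℝ)..y, (1 + |s| ^ q)⁻¹ with hG
  have hd : ∀ y, HasDerivAt G ((1 + |y| ^ q)⁻¹) y := fun y =>
    intervalIntegral.integral_hasDerivAt_right (hcont.intervalIntegrable _ _)
      (hcont.stronglyMeasurableAtFilter _ _) hcont.continuousAt
  have hmono : StrictMono G := strictMono_of_hasDerivAt_pos hd fun y => by positivity
  have hGc : Continuous G := continuous_iff_continuousAt.2 fun y => (hd y).continuousAt
  have hG0 : G 0 = 0 := by simp [hG]
  have hodd : ∀ y, G (-y) = -G y := fun y => by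
    have := intervalIntegral.integral_comp_neg (a := 0) (b := y) (fun s : ℝ => (1 + |s| ^ q)⁻¹)
    simp only [abs_neg, neg_zero] at this
    simp only [hG]
    rw [this, intervalIntegral.integral_symm]
  have hlim : Filter.Tendsto G Filter.atTop (nhds A) := by
    rw [hA, ← hval]
    exact intervalIntegral_tendsto_integral_Ioi 0 hint Filter.tendsto_id
  have hlt : ∀ y, G y < A := fun y =>
    (hmono (lt_add_one y)).trans_le (hmono.monotone.ge_of_tendsto hlim _)
  have hrange : range G = Ioo (-A) A := by
    refine Subset.antisymm ?_ fun t ht => ?_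
    · rintro _ ⟨y, rfl⟩
      exact ⟨by have := hlt (-y); rw [hodd] at this; linarith, hlt y⟩
    · obtain ⟨y₁, h₁⟩ := (hlim.eventually (lt_mem_nhds ht.2)).exists
      obtain ⟨y₂, h₂⟩ := (hlim.eventually (lt_mem_nhds (show -t < A by linarith [ht.1]))).exists
      exact mem_range_of_exists_le_of_exists_ge hGc ⟨-y₂, by rw [hodd]; linarith⟩ ⟨y₁, h₁.le⟩
  have hemb : Topology.IsOpenEmbedding G :=
    ⟨hmono.isEmbedding_of_ordConnected (by rw [hrange]; exact ordConnected_Ioo),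
      by rw [hrange]; exact isOpen_Ioo⟩
  let e := hemb.toOpenPartialHomeomorph G
  have htarget : e.target = Ioo (-A) A := by
    rw [← hrange]; simp [e]
  have hright : ∀ t ∈ Ioo (-A) A, G (e.symm t) = t := fun t ht =>
    e.right_inv (by rwa [htarget])
  refine ⟨e.symm, fun t ht => ?_, ?_, ?_⟩
  · have := e.hasDerivAt_symm (a := t) (by rwa [htarget])
      (f' := (1 + |e.symm t| ^ q)⁻¹) (by positivity) (hd _)
    rwa [inv_inv] at this
  · have hA0 : 0 < A := hG0 ▸ hlt 0
    apply hmono.injective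
    rw [hright 0 ⟨by linarith, hA0⟩, hG0]
  · refine Filter.tendsto_atTop.2 fun M => ?_
    filter_upwards [Ioo_mem_nhdsLT (hlt M)] with t ht
    have : -A < G M := (hrange ▸ mem_range_self M : G M ∈ Ioo (-A) A).1
    rw [← hmono.le_iff_le, hright t ⟨this.trans ht.1, ht.2⟩]
    exact ht.1.le

theorem exists_riccati_solution {p q T κ : ℝ} (hpq : p.HolderConjugate q) (hκ : 0 < κ)
    (hT : κ * (T / 2) < Real.pi / (q * Real.sin (Real.pi / q))) :
    ∃ h : ℝ → ℝ, ∀ x ∈ Icc 0 T,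
      HasDerivAt h (-(κ ^ p / (p - 1) ^ (p - 1)) - (p - 1) * |h x| ^ q) x := by
  obtain ⟨τ, hτ, -⟩ := exists_generalized_tan hpq.symm.lt rfl
  have hp : 0 < p - 1 := hpq.sub_one_pos
  -- The amplitude for which cκ and (p-1)c^q both equal the constant term of the equation.
  set c := (κ / (p - 1)) ^ (p - 1) with hc
  have hc0 : 0 < c := by positivity
  have hc1 : c * κ = κ ^ p / (p - 1) ^ (p - 1) := by
    rw [hc, Real.div_rpow hκ.le hp.le, Real.rpow_sub_one hκ.ne']
    field_simp
  have hc2 : (p - 1) * c ^ q = κ ^ p / (p - 1) ^ (p - 1) := by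
    rw [hc, ← Real.rpow_mul (by positivity), hpq.sub_one_mul_conj, Real.div_rpow hκ.le hp.le,
      Real.rpow_sub_one hp.ne']
    field_simp
  -- Centring at T/2 uses both halves of (-A, A), so the admissible length is doubled.
  refine ⟨fun x => -c * τ (κ * (x - T / 2)), fun x hx => ?_⟩
  have h1 : HasDerivAt (fun x => κ * (x - T / 2)) κ x := by
    simpa using ((hasDerivAt_id x).sub_const (T / 2)).const_mul κ
  have hmem : κ * (x - T / 2) ∈ Ioo (-(Real.pi / (q * Real.sin (Real.pi / q))))
      (Real.pi / (q * Real.sin (Real.pi / q))) :=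
    ⟨by nlinarith [mul_nonneg hκ.le hx.1], by nlinarith [mul_le_mul_of_nonneg_left hx.2 hκ.le]⟩
  refine (((hτ _ hmem).comp x h1).const_mul (-c)).congr_deriv ?_
  rw [abs_mul, abs_neg, abs_of_pos hc0, Real.mul_rpow hc0.le (abs_nonneg _)]
  linear_combination (|τ (κ * (x - T / 2))| ^ q) * (hc2 - hc1) - hc1

/-! ### Closed walks through every edge twice. -/

namespace MetricGraph

variable {V E : Type*} (Γ : MetricGraph V E)

/-- The initial vertex of an edge traversed forwards (`true`) or backwards (`false`). -/
def dartSrc (d : E × Bool) : V := if d.2 then Γ.src d.1 else Γ.tgt d.1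

/-- The terminal vertex of an edge traversed forwards (`true`) or backwards (`false`). -/
def dartTgt (d : E × Bool) : V := if d.2 then Γ.tgt d.1 else Γ.src d.1

/-- The oriented edges in the list form a walk from the first vertex to the second one. -/
def IsWalk : V → List (E × Bool) → V → Prop
  | v, [], w => v = w
  | v, d :: l, w => Γ.dartSrc d = v ∧ IsWalk (Γ.dartTgt d) l w

theorem isWalk_append {v w : V} {l₁ l₂ : List (E × Bool)} :
    Γ.IsWalk v (l₁ ++ l₂) w ↔ ∃ m, Γ.IsWalk v l₁ m ∧ Γ.IsWalk m l₂ w := by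
  induction l₁ generalizing v with
  | nil => simp [IsWalk]
  | cons d l ih => simp [IsWalk, ih, and_assoc]

theorem isWalk_roundTrip (d : E × Bool) :
    Γ.IsWalk (Γ.dartSrc d) [d, (d.1, !d.2)] (Γ.dartSrc d) := by
  rcases d with ⟨e, _ | _⟩ <;> simp [IsWalk, dartSrc, dartTgt]

/-- `l` is a closed walk from `v` that goes exactly twice through every edge of `S`, and through no
other edge. -/
structure IsDoubleTour (v : V) (S : Finset E) (l : List (E × Bool)) : Prop where
  isWalk : Γ.IsWalk v l v
  exists_mem : ∀ e ∈ S, ∃ b, (e, b) ∈ l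
  sum_eq : ∀ f : E → ℝ, (l.map fun d => f d.1).sum = 2 * ∑ e ∈ S, f e

variable {Γ}

/-- By connectedness, some edge outside S has an end on the tour; a round trip along it is spliced
in there. -/
theorem IsDoubleTour.exists_insert {v : V} {S : Finset E} {l : List (E × Bool)}
    (h : Γ.IsDoubleTour v S l) (hΓ : Γ.Connected) [Fintype E] (hS : S ≠ Finset.univ) :
    ∃ (S' : Finset E) (l' : List (E × Bool)), S'.card = S.card + 1 ∧ Γ.IsDoubleTour v S' l' := by
  classical
  let visited : V → Prop := fun m =>
    ∃ l₁ l₂, l = l₁ ++ l₂ ∧ Γ.IsWalk v l₁ m ∧ Γ.IsWalk m l₂ v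
  -- Otherwise the visited vertices are closed under adjacency, so all vertices are visited and S
  -- contains every edge.
  have hext : ∃ d : E × Bool, d.1 ∉ S ∧ visited (Γ.dartSrc d) := by
    by_contra hcon
    push Not at hcon
    have hin : ∀ e b, visited (Γ.dartSrc (e, b)) → e ∈ S := fun e b hv => by
      by_contra hne
      exact hcon (e, b) hne hv
    have hends : ∀ e ∈ S, visited (Γ.src e) ∧ visited (Γ.tgt e) := fun e he => by
      obtain ⟨b, hb⟩ := h.exists_mem e he
      obtain ⟨l₁, l₂, rfl⟩ := List.append_of_mem hb
      obtain ⟨m, hm₁, hm₂, hm₃⟩ := (Γ.isWalk_append).1 h.isWalk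
      have h1 : visited (Γ.dartSrc (e, b)) := ⟨l₁, (e, b) :: l₂, rfl, hm₂ ▸ hm₁, rfl, hm₃⟩
      have h2 : visited (Γ.dartTgt (e, b)) :=
        ⟨l₁ ++ [(e, b)], l₂, by simp, (Γ.isWalk_append).2 ⟨m, hm₁, hm₂, rfl⟩, hm₃⟩
      cases b
      · exact ⟨h2, h1⟩
      · exact ⟨h1, h2⟩
    have hall : ∀ w, visited w := fun w => by
      induction hΓ.2 v w with
      | refl => exact ⟨[], l, rfl, rfl, h.isWalk⟩
      | tail _ hadj ih =>
        obtain ⟨e, ⟨rfl, rfl⟩ | ⟨rfl, rfl⟩⟩ := hadj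
        · exact (hends e (hin e true ih)).2
        · exact (hends e (hin e false ih)).1
    exact hS (Finset.eq_univ_of_forall fun e => hin e true (hall _))
  obtain ⟨d, hd, l₁, l₂, rfl, h₁, h₂⟩ := hext
  refine ⟨insert d.1 S, l₁ ++ ([d, (d.1, !d.2)] ++ l₂), Finset.card_insert_of_notMem hd, ?_, ?_, ?_⟩
  · exact (Γ.isWalk_append).2 ⟨_, h₁, (Γ.isWalk_append).2 ⟨_, Γ.isWalk_roundTrip d, h₂⟩⟩
  · intro e he
    rcases Finset.mem_insert.1 he with rfl | he
    · exact ⟨d.2, by simp⟩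
    · obtain ⟨b, hb⟩ := h.exists_mem e he
      refine ⟨b, ?_⟩
      rcases List.mem_append.1 hb with hb | hb <;> simp [hb]
  · intro f
    have := h.sum_eq f
    rw [List.map_append, List.sum_append] at this
    rw [Finset.sum_insert hd]
    simp only [List.map_append, List.sum_append, List.map_cons, List.map_nil, List.sum_cons,
      List.sum_nil]
    linarith

theorem Connected.exists_isDoubleTour (hΓ : Γ.Connected) [Fintype E] (v : V) :
    ∃ l, Γ.IsDoubleTour v Finset.univ l := by
  have key : ∀ k ≤ Fintype.card E, ∃ (S : Finset E) (l : List (E × Bool)),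
      S.card = k ∧ Γ.IsDoubleTour v S l := fun k => by
    induction k with
    | zero => exact fun _ => ⟨∅, [], rfl, rfl, by simp, by simp⟩
    | succ k ih =>
      intro hk
      obtain ⟨S, l, hS, hl⟩ := ih (by omega)
      obtain ⟨S', l', hS', hl'⟩ := hl.exists_insert hΓ (by
        rintro rfl
        rw [Finset.card_univ] at hS
        omega)
      exact ⟨S', l', by omega, hl'⟩
  obtain ⟨S, l, hS, hl⟩ := key _ le_rfl
  obtain rfl := Finset.eq_univ_of_card S hS
  exact ⟨l, hl⟩

/-! ### The lower bound for Sobolev functions on the graph. -/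

theorem IsSobolev.riccati_boundary_le {p q l : ℝ} (hpq : p.HolderConjugate q)
    {u : GraphFunction V E} {du : E → ℝ → ℝ} (hu : Γ.IsSobolev p u du) (e : E) {h : ℝ → ℝ}
    (hh : ∀ x ∈ Icc 0 (Γ.length e), HasDerivAt h (-l - (p - 1) * |h x| ^ q) x) :
    h (Γ.length e) * |u.onVertex (Γ.tgt e)| ^ p - h 0 * |u.onVertex (Γ.src e)| ^ p ≤
      (∫ x in Ioo 0 (Γ.length e), |du e x| ^ p) -
        l * ∫ x in Ioo 0 (Γ.length e), |u.onEdge e x| ^ p := by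
  have hL := Γ.length_pos e
  have hp := hpq.lt
  have hg : IntegrableOn (du e) (Ioo 0 (Γ.length e)) :=
    (hu.memLp_deriv e).integrable (by
      rw [← ENNReal.ofReal_one]; exact ENNReal.ofReal_le_ofReal hp.le)
  obtain ⟨h1, h2⟩ := (hu.hasWeakDeriv e).absolutelyContinuousOnInterval hL
    (hu.isContinuous.continuousOn e) hg
  rw [← hu.isContinuous.src_eq, ← hu.isContinuous.tgt_eq]
  refine _root_.riccati_boundary_le hpq hL hh h1 h2 ?_
  have := (hu.memLp_deriv e).integrable_norm_rpow (by simpa using hpq.pos) ENNReal.ofReal_ne_top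
  simp only [ENNReal.toReal_ofReal hpq.nonneg, Real.norm_eq_abs] at this
  exact this

theorem IsSobolev.riccati_walk_le {p q l T : ℝ} (hpq : p.HolderConjugate q)
    {u : GraphFunction V E} {du : E → ℝ → ℝ} (hu : Γ.IsSobolev p u du) {h : ℝ → ℝ}
    (hh : ∀ x ∈ Icc 0 T, HasDerivAt h (-l - (p - 1) * |h x| ^ q) x)
    {v w : V} {ds : List (E × Bool)} (hw : Γ.IsWalk v ds w) {s : ℝ} (hs : 0 ≤ s)
    (hsT : s + (ds.map fun d => Γ.length d.1).sum ≤ T) :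
    h (s + (ds.map fun d => Γ.length d.1).sum) * |u.onVertex w| ^ p - h s * |u.onVertex v| ^ p ≤
      (ds.map fun d => (∫ x in Ioo 0 (Γ.length d.1), |du d.1 x| ^ p) -
        l * ∫ x in Ioo 0 (Γ.length d.1), |u.onEdge d.1 x| ^ p).sum := by
  induction ds generalizing v s with
  | nil =>
    obtain rfl : v = w := hw
    simp
  | cons d ds ih =>
    obtain ⟨rfl, hw⟩ := hw
    simp only [List.map_cons, List.sum_cons, ← add_assoc] at hsT ⊢
    have hpos : 0 < Γ.length d.1 := Γ.length_pos d.1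
    have hnn : 0 ≤ (ds.map fun d => Γ.length d.1).sum :=
      List.sum_nonneg (List.forall_mem_map.2 fun d _ => (Γ.length_pos d.1).le)
    have h1 := ih hw (s := s + Γ.length d.1) (by linarith) hsT
    have h2 : h (s + Γ.length d.1) * |u.onVertex (Γ.dartTgt d)| ^ p -
        h s * |u.onVertex (Γ.dartSrc d)| ^ p ≤
        (∫ x in Ioo 0 (Γ.length d.1), |du d.1 x| ^ p) -
        l * ∫ x in Ioo 0 (Γ.length d.1), |u.onEdge d.1 x| ^ p := by
      rcases d with ⟨e, _ | _⟩
      -- Reversing the coordinate and the sign preserves the Riccati equation, which handles an edge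
      -- traversed backwards.
      · have := hu.riccati_boundary_le hpq (l := l) e (h := fun x => -h (s + Γ.length e - x))
          fun x hx => by
            have h3 := (hh (s + Γ.length e - x) ⟨by linarith [hx.2], by linarith [hx.1]⟩).comp x
              ((hasDerivAt_id x).const_sub (s + Γ.length e))
            refine h3.neg.congr_deriv ?_
            rw [abs_neg]
            ring
        simp only [sub_zero, add_sub_cancel_right] at this
        simp only [dartTgt, dartSrc]
        simp only [Bool.false_eq_true, if_false]
        linarith
      · have := hu.riccati_boundary_le hpq (l := l) e (h := fun x => h (s + x))
          fun x hx => (hh (s + x) ⟨by linarith [hx.1], by linarith [hx.2]⟩).comp_const_add s x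
        simpa [dartTgt, dartSrc] using this
    linarith

theorem totalLength_pos [Fintype E] [Nonempty E] (Γ : MetricGraph V E) : 0 < Γ.totalLength :=
  Finset.sum_pos (fun e _ => Γ.length_pos e) Finset.univ_nonempty

/-- At the critical κ = W the Riccati solution blows up at both ends of the tour, so the estimate is
proved for κ < W and passed to the limit. -/
theorem IsSobolev.integralAbsPow_le [Fintype E] [Nonempty E] {p q : ℝ}
    (hpq : p.HolderConjugate q) {u : GraphFunction V E} {du : E → ℝ → ℝ}
    (hu : Γ.IsSobolev p u du) (hΓ : Γ.Connected) {v : V} (hv : u.onVertex v = 0) :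
    (Real.pi / (q * Real.sin (Real.pi / q)) / Γ.totalLength) ^ p / (p - 1) ^ (p - 1) *
      Γ.integralAbsPow p u.onEdge ≤ Γ.integralAbsPow p du := by
  set W := Real.pi / (q * Real.sin (Real.pi / q)) / Γ.totalLength with hW
  have hℓ := Γ.totalLength_pos
  have hW0 : 0 < W := by
    have := sin_pi_div_pos hpq.symm.lt
    have := hpq.symm.pos
    positivity
  obtain ⟨ds, hds⟩ := hΓ.exists_isDoubleTour v
  have key : ∀ κ, 0 < κ → κ < W → κ ^ p / (p - 1) ^ (p - 1) * Γ.integralAbsPow p u.onEdge ≤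
      Γ.integralAbsPow p du := fun κ hκ hκW => by
    obtain ⟨h, hh⟩ := exists_riccati_solution (T := 2 * Γ.totalLength) hpq hκ (by
      rw [mul_div_cancel_left₀ _ two_ne_zero]
      exact (lt_div_iff₀ hℓ).1 hκW)
    have h1 := hu.riccati_walk_le hpq hh hds.isWalk (s := 0) le_rfl
      (by rw [hds.sum_eq]; simp [totalLength])
    rw [hds.sum_eq fun e => (∫ x in Ioo 0 (Γ.length e), |du e x| ^ p) -
        κ ^ p / (p - 1) ^ (p - 1) * ∫ x in Ioo 0 (Γ.length e), |u.onEdge e x| ^ p, hv, abs_zero,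
      Real.zero_rpow hpq.ne_zero, Finset.sum_sub_distrib, ← Finset.mul_sum] at h1
    simp only [integralAbsPow]
    linarith
  have hlim : Filter.Tendsto
      (fun κ => κ ^ p / (p - 1) ^ (p - 1) * Γ.integralAbsPow p u.onEdge)
      (nhdsWithin W (Iio W)) (nhds (W ^ p / (p - 1) ^ (p - 1) * Γ.integralAbsPow p u.onEdge)) := by
    refine ((((Real.continuousAt_rpow_const W p (Or.inl hW0.ne')).div_const _).mul_const
      _).tendsto).mono_left nhdsWithin_le_nhds
  refine le_of_tendsto hlim ?_
  filter_upwards [Ioo_mem_nhdsLT hW0] with κ hκ using key κ hκ.1 hκ.2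

theorem IsSobolev.integralAbsPow_pos [Fintype E] {p : ℝ} (hp : 0 < p) {u : GraphFunction V E}
    {du : E → ℝ → ℝ} (hu : Γ.IsSobolev p u du) (hne : Γ.IsNonzero u) :
    0 < Γ.integralAbsPow p u.onEdge := by
  obtain ⟨e, x, hx, hux⟩ := hne
  have hnn : ∀ e, 0 ≤ ∫ x in Ioo 0 (Γ.length e), |u.onEdge e x| ^ p := fun e =>
    integral_nonneg fun x => by positivity
  refine Finset.sum_pos' (fun e _ => hnn e) ⟨e, Finset.mem_univ e, ?_⟩
  have hL := Γ.length_pos e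
  have hc := hu.isContinuous.continuousOn e
  have hcp : ContinuousOn (fun x => |u.onEdge e x| ^ p) (Icc 0 (Γ.length e)) :=
    hc.abs.rpow_const fun x _ => Or.inr hp.le
  refine (hnn e).lt_of_ne fun h0 => hux ?_
  have h1 := (setIntegral_eq_zero_iff_of_nonneg_ae
    (Filter.Eventually.of_forall fun x => by positivity)
    (hcp.integrableOn_Icc.mono_set Ioo_subset_Icc_self)).1 h0.symm
  rw [Measure.restrict_congr_set Ioo_ae_eq_Icc] at h1
  have h2 := Measure.eqOn_Icc_of_ae_eq (μ := volume) hL.ne h1 hcp continuousOn_const hx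
  have h3 : |u.onEdge e x| ^ p = 0 := h2
  simpa using (Real.rpow_eq_zero (abs_nonneg _) hp.ne').1 h3

end MetricGraph

/-! ### The extremal function on a segment and the constant. -/

theorem hasWeakDerivOn_of_hasDerivAt {L : ℝ} (hL : 0 < L) {u g : ℝ → ℝ}
    (hu : ContinuousOn u (Icc 0 L)) (hd : ∀ x ∈ Ioo 0 L, HasDerivAt u (g x) x)
    (hg : IntegrableOn g (Ioo 0 L)) : HasWeakDerivOn 0 L u g := by
  intro φ h1 _ h3
  have hz : ∀ x, x ∉ Ioo 0 L → φ x = 0 := fun x hx =>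
    image_eq_zero_of_notMem_tsupport fun hh => hx (h3 hh)
  have hφ' : Continuous (deriv φ) := h1.continuous_deriv (by simp)
  have hi1 : IntegrableOn (fun x => g x * φ x) (Ioo 0 L) :=
    (((integrableOn_Icc_iff_integrableOn_Ioo (μ := volume)).2 hg).mul_continuousOn
      h1.continuous.continuousOn isCompact_Icc).mono_set Ioo_subset_Icc_self
  have hi2 : IntegrableOn (fun x => u x * deriv φ x) (Ioo 0 L) :=
    ((hu.mul hφ'.continuousOn).integrableOn_Icc).mono_set Ioo_subset_Icc_self
  have h4 := intervalIntegral.integral_eq_sub_of_hasDerivAt_of_le hL.le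
    (f := fun x => u x * φ x) (hu.mul h1.continuous.continuousOn)
    (fun x hx => (hd x hx).mul ((h1.differentiable (by simp)) x).hasDerivAt)
    ((intervalIntegrable_iff_integrableOn_Ioo_of_le hL.le).2 (hi1.add hi2))
  rw [hz L (by simp), hz 0 (by simp), intervalIntegral.integral_of_le hL.le,
    integral_Ioc_eq_integral_Ioo, integral_add hi1 hi2] at h4
  linarith

theorem memLp_of_continuousOn_of_bounded {L C : ℝ} {f : ℝ → ℝ} {r : ENNReal}
    (hf : ContinuousOn f (Ioo 0 L)) (hC : ∀ x ∈ Ioo 0 L, |f x| ≤ C) :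
    MemLp f r (volume.restrict (Ioo 0 L)) :=
  MemLp.of_bound (hf.aestronglyMeasurable measurableSet_Ioo) C
    ((ae_restrict_iff' measurableSet_Ioo).2 (Filter.Eventually.of_forall hC))

theorem continuousOn_update_Icc {f : ℝ → ℝ} {A : ℝ} (hf : ContinuousOn f (Ico 0 A))
    (hlim : Filter.Tendsto f (nhdsWithin A (Iio A)) (nhds 0)) :
    ContinuousOn (Function.update f A 0) (Icc 0 A) := by
  rw [continuousOn_update_iff, Icc_sdiff_right]
  exact ⟨hf, fun _ => hlim.mono_left (nhdsWithin_mono _ fun x hx => hx.2)⟩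

/-- The generalized sine function, reflected so that it attains its maximum at `0` and vanishes at
`A`, and its derivative. -/
theorem exists_generalized_sine {p q A : ℝ} (hpq : p.HolderConjugate q)
    (hA : A = Real.pi / (q * Real.sin (Real.pi / q))) :
    ∃ S g : ℝ → ℝ, ContinuousOn S (Icc 0 A) ∧ S 0 = 1 ∧ S A = 0 ∧
      (∀ t ∈ Ioo 0 A, HasDerivAt S (g t) t) ∧ ContinuousOn g (Ioo 0 A) ∧
      (∃ C, ∀ t ∈ Ioo 0 A, |g t| ≤ C) ∧
      (p - 1) ^ (p - 1) * ∫ t in Ioo 0 A, |g t| ^ p = ∫ t in Ioo 0 A, |S t| ^ p := by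
  obtain ⟨τ, hτ, hτ0, hτlim⟩ := exists_generalized_tan hpq.symm.lt hA
  have hp := hpq.lt
  have hp0 := hpq.pos
  have hq := hpq.symm.lt
  have hq0 := hpq.symm.pos
  have hA0 : 0 < A := by
    have := sin_pi_div_pos hq
    rw [hA]; positivity
  have hqp : q / p = q - 1 := hpq.symm.div_conj_eq_sub_one
  set f : ℝ → ℝ := fun t => (1 + |τ t| ^ q) ^ (-(1 / p)) with hf
  -- This is τ|f|^p. Its derivative is |f|^p - (p-1)^(p-1)|g|^p and it vanishes at 0 and in the
  -- limit at A, which gives the integral identity.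
  set k : ℝ → ℝ := fun t => τ t / (1 + |τ t| ^ q) with hk
  set g : ℝ → ℝ := fun t => -((q - 1) * (|τ t| ^ (q - 2) * τ t) * f t) with hg
  have hpos : ∀ y : ℝ, 0 < 1 + |y| ^ q := fun y => by positivity
  have hmem : ∀ t ∈ Ico 0 A, t ∈ Ioo (-A) A := fun t ht => ⟨by linarith [ht.1], ht.2⟩
  have habs : ∀ y : ℝ, |(|y| ^ (q - 2) * y)| = |y| ^ (q - 1) := fun y => by
    rcases eq_or_ne y 0 with rfl | hy
    · simp [Real.zero_rpow (sub_pos.2 hq).ne']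
    · rw [abs_mul, abs_of_nonneg (Real.rpow_nonneg (abs_nonneg y) _),
        ← Real.rpow_add_one (abs_pos.2 hy).ne']
      congr 1; ring
  have hmul : ∀ y : ℝ, y * (|y| ^ (q - 2) * y) = |y| ^ q := fun y => by
    rcases eq_or_ne y 0 with rfl | hy
    · simp [hq0.ne']
    · have hy' := abs_pos.2 hy
      rw [show y * (|y| ^ (q - 2) * y) = |y| ^ (q - 2) * |y| ^ 2 by rw [sq_abs]; ring,
        ← Real.rpow_natCast, ← Real.rpow_add hy']
      congr 1; push_cast; ring
  have hden : ∀ t ∈ Ioo (-A) A, HasDerivAt (fun t => 1 + |τ t| ^ q)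
      (q * |τ t| ^ (q - 2) * τ t * (1 + |τ t| ^ q)) t := fun t ht =>
    ((hasDerivAt_abs_rpow (τ t) hq).comp t (hτ t ht)).const_add 1
  have hfd : ∀ t ∈ Ioo (-A) A, HasDerivAt f (g t) t := fun t ht => by
    refine ((hden t ht).rpow_const (Or.inl (hpos _).ne')).congr_deriv ?_
    simp only [hg, hf]
    rw [Real.rpow_sub_one (hpos _).ne', ← hqp]
    have := (hpos (τ t)).ne'
    field_simp
  have hfp : ∀ t, |f t| ^ p = (1 + |τ t| ^ q)⁻¹ := fun t => by
    simp only [hf]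
    rw [abs_of_pos (Real.rpow_pos_of_pos (hpos _) _), ← Real.rpow_mul (hpos _).le,
      neg_mul, one_div_mul_cancel hp0.ne', Real.rpow_neg_one]
  have hgp : ∀ t, |g t| ^ p = (q - 1) ^ p * (|τ t| ^ q * (1 + |τ t| ^ q)⁻¹) := fun t => by
    simp only [hg]
    rw [abs_neg, abs_mul, abs_mul, habs, abs_of_pos (sub_pos.2 hq),
      Real.mul_rpow (mul_nonneg (sub_pos.2 hq).le (by positivity)) (abs_nonneg _), hfp,
      Real.mul_rpow (sub_pos.2 hq).le (by positivity), ← Real.rpow_mul (abs_nonneg _),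
      hpq.symm.sub_one_mul_conj, mul_assoc]
  have hconst : (p - 1) ^ (p - 1) * (q - 1) ^ p = q - 1 := by
    have h1 : q - 1 = (p - 1)⁻¹ := by
      rw [hpq.conjugate_eq]
      have := (sub_pos.2 hp).ne'
      field_simp
      ring
    have hp1 := sub_pos.2 hp
    rw [h1, Real.inv_rpow hp1.le, Real.rpow_sub_one hp1.ne']
    have : (p - 1) ^ p ≠ 0 := by positivity
    field_simp
  have hkd : ∀ t ∈ Ioo (-A) A,
      HasDerivAt k (|f t| ^ p - (p - 1) ^ (p - 1) * |g t| ^ p) t := fun t ht => by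
    refine ((hτ t ht).div (hden t ht) (hpos _).ne').congr_deriv ?_
    rw [hfp, hgp, ← mul_assoc ((p - 1) ^ (p - 1)), hconst,
      show τ t * (q * |τ t| ^ (q - 2) * τ t * (1 + |τ t| ^ q)) =
        q * (τ t * (|τ t| ^ (q - 2) * τ t)) * (1 + |τ t| ^ q) by ring, hmul]
    have := (hpos (τ t)).ne'
    field_simp
    ring
  have hflim : Filter.Tendsto f (nhdsWithin A (Iio A)) (nhds 0) := by
    refine (tendsto_rpow_neg_atTop (y := 1 / p) (by positivity)).comp ?_
    refine Filter.tendsto_atTop_add_const_left _ _ ?_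
    exact (tendsto_rpow_atTop hq0).comp (Filter.tendsto_abs_atTop_atTop.comp hτlim)
  have hklim : Filter.Tendsto k (nhdsWithin A (Iio A)) (nhds 0) := by
    refine squeeze_zero' ?_ ?_
      ((tendsto_rpow_neg_atTop (y := q - 1) (sub_pos.2 hq)).comp hτlim)
    · filter_upwards [hτlim.eventually_gt_atTop 0] with t ht
      exact div_nonneg ht.le (hpos _).le
    · filter_upwards [hτlim.eventually_gt_atTop 0] with t ht
      simp only [hk, Function.comp]
      rw [neg_sub, Real.rpow_sub ht, Real.rpow_one, abs_of_pos ht]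
      have : 0 < τ t ^ q := by positivity
      gcongr
      linarith
  have hfc : ContinuousOn f (Ico 0 A) := fun t ht =>
    (hfd t (hmem t ht)).continuousAt.continuousWithinAt
  have hkc : ContinuousOn k (Ico 0 A) := fun t ht =>
    (hkd t (hmem t ht)).continuousAt.continuousWithinAt
  -- Nothing is known about τ at A itself, so f and k are given their limit 0 there.
  have hupd : ∀ (F : ℝ → ℝ) (t), t ∈ Ioo 0 A → Function.update F A 0 t = F t := fun F t ht =>
    Function.update_of_ne ht.2.ne _ _
  have hupdd : ∀ (F : ℝ → ℝ) (F' t : ℝ), t ∈ Ioo 0 A → HasDerivAt F F' t →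
      HasDerivAt (Function.update F A 0) F' t := fun F F' t ht h => by
    refine h.congr_of_eventuallyEq ?_
    filter_upwards [isOpen_Ioo.mem_nhds ht] with s hs using hupd F s hs
  have hsub : ∀ t ∈ Ioo 0 A, t ∈ Ioo (-A) A := fun t ht => hmem t ⟨ht.1.le, ht.2⟩
  have hgc : ContinuousOn g (Ioo 0 A) := by
    have hτc : ContinuousOn τ (Ioo 0 A) := fun t ht =>
      (hτ t (hsub t ht)).continuousAt.continuousWithinAt
    -- For q < 2 the first factor is singular at 0; continuity is read off from the derivative of
    -- |y|^q.
    have h1 : Continuous fun y : ℝ => |y| ^ (q - 2) * y := by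
      have h2 : ContDiff ℝ 1 (fun y : ℝ => |y| ^ q) := by
        simpa using contDiff_norm_rpow (E := ℝ) hq
      have h3 := (h2.continuous_deriv le_rfl).const_mul q⁻¹
      refine h3.congr fun y => ?_
      rw [(hasDerivAt_abs_rpow y hq).deriv]
      field_simp
    exact ((continuousOn_const.mul (h1.comp_continuousOn hτc)).mul
      (hfc.mono Ioo_subset_Ico_self)).neg
  have hgb : ∀ t, |g t| ≤ q - 1 := fun t => by
    refine (Real.rpow_le_rpow_iff (abs_nonneg _) (sub_pos.2 hq).le hp0).1 ?_
    rw [hgp]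
    refine mul_le_of_le_one_right (Real.rpow_nonneg (sub_pos.2 hq).le _) ?_
    rw [← div_eq_mul_inv, div_le_one (hpos _)]
    linarith
  have hSc := continuousOn_update_Icc hfc hflim
  refine ⟨Function.update f A 0, g, hSc, ?_, Function.update_self _ _ _,
    fun t ht => hupdd f _ t ht (hfd t (hsub t ht)), hgc, ⟨q - 1, fun t _ => hgb t⟩, ?_⟩
  · rw [Function.update_of_ne hA0.ne]
    simp [hf, hτ0, hq0.ne']
  · have hcongr : ∫ t in Ioo 0 A, |Function.update f A 0 t| ^ p = ∫ t in Ioo 0 A, |f t| ^ p :=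
      setIntegral_congr_fun measurableSet_Ioo fun t ht => by simp only [hupd f t ht]
    have hi1 : IntegrableOn (fun t => |f t| ^ p) (Ioo 0 A) := by
      have h1 : IntegrableOn (fun t => |Function.update f A 0 t| ^ p) (Ioo 0 A) :=
        ((hSc.abs.rpow_const fun x _ => Or.inr hp0.le).integrableOn_Icc).mono_set
          Ioo_subset_Icc_self
      exact h1.congr_fun (fun t ht => by simp only [hupd f t ht]) measurableSet_Ioo
    have hi2 : IntegrableOn (fun t => |g t| ^ p) (Ioo 0 A) := by
      have := (memLp_of_continuousOn_of_bounded (r := ENNReal.ofReal p) hgc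
        fun t _ => hgb t).integrable_norm_rpow (by simpa using hp0) ENNReal.ofReal_ne_top
      simp only [ENNReal.toReal_ofReal hp0.le, Real.norm_eq_abs] at this
      exact this
    have h1 := intervalIntegral.integral_eq_sub_of_hasDerivAt_of_le hA0.le
      (continuousOn_update_Icc hkc hklim)
      (fun t ht => hupdd k _ t ht (hkd t (hsub t ht)))
      ((intervalIntegrable_iff_integrableOn_Ioo_of_le hA0.le).2 (hi1.sub (hi2.const_mul _)))
    rw [Function.update_self, Function.update_of_ne hA0.ne, intervalIntegral.integral_of_le hA0.le,
      integral_Ioc_eq_integral_Ioo, integral_sub hi1 (hi2.const_mul _), integral_const_mul] at h1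
    simp only [hk, hτ0, zero_div, sub_zero] at h1
    rw [hcongr]
    linarith

/-- Since π/p + π/q = π, the two sines agree, and A = (p-1)π_p/2. -/
theorem piP_div_rpow_mul {p q l : ℝ} (hpq : p.HolderConjugate q) (hl : 0 < l) :
    (piP p / (2 * l)) ^ p * (p / q) =
      (Real.pi / (q * Real.sin (Real.pi / q)) / l) ^ p / (p - 1) ^ (p - 1) := by
  have hp1 : 0 < p - 1 := hpq.sub_one_pos
  have hp0 := hpq.pos
  have hq0 := hpq.symm.pos
  have hs := sin_pi_div_pos hpq.lt
  have hsin : Real.sin (Real.pi / q) = Real.sin (Real.pi / p) := by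
    rw [← Real.sin_pi_sub]
    congr 1
    have := hpq.inv_add_inv_eq_one
    rw [div_eq_mul_inv, div_eq_mul_inv]
    linear_combination Real.pi * (-this)
  have h1 : Real.pi / (q * Real.sin (Real.pi / q)) / l = (p - 1) * (piP p / (2 * l)) := by
    rw [hsin, piP, ← hpq.div_conj_eq_sub_one]
    field_simp
  have hpi : 0 < piP p / (2 * l) := by unfold piP; positivity
  rw [h1, hpq.div_conj_eq_sub_one, Real.mul_rpow hp1.le hpi.le, Real.rpow_sub_one hp1.ne']
  have : (p - 1) ^ p ≠ 0 := by positivity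
  field_simp

/-! ### The first eigenvalue: lower bound and equality on the segment. -/

namespace MetricGraph

variable {V E : Type*} {Γ : MetricGraph V E}

theorem IsContinuous.isSobolev_of_hasDerivAt {p : ℝ} {u : GraphFunction V E} {du : E → ℝ → ℝ}
    (hu : Γ.IsContinuous u)
    (hd : ∀ e, ∀ x ∈ Ioo 0 (Γ.length e), HasDerivAt (u.onEdge e) (du e x) x)
    (hc : ∀ e, ContinuousOn (du e) (Ioo 0 (Γ.length e)))
    (hb : ∀ e, ∃ C, ∀ x ∈ Ioo 0 (Γ.length e), |du e x| ≤ C) : Γ.IsSobolev p u du := by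
  refine ⟨hu, fun e => ?_, fun e => ?_, fun e => ?_⟩
  · obtain ⟨C, hC⟩ := isCompact_Icc.exists_bound_of_continuousOn (hu.continuousOn e)
    exact memLp_of_continuousOn_of_bounded ((hu.continuousOn e).mono Ioo_subset_Icc_self)
      fun x hx => hC x (Ioo_subset_Icc_self hx)
  · obtain ⟨C, hC⟩ := hb e
    exact memLp_of_continuousOn_of_bounded (hc e) hC
  · obtain ⟨C, hC⟩ := hb e
    exact hasWeakDerivOn_of_hasDerivAt (Γ.length_pos e) (hu.continuousOn e) (hd e)
      ((memLp_of_continuousOn_of_bounded (r := 1) (hc e) hC).integrable le_rfl)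

/-- Needed because the real infimum of the empty set is 0. The parabolas x(ℓ_e - x) vanish at all
vertices, so they suit every Dirichlet set. -/
theorem rayleighQuotients_nonempty [Fintype E] [Nonempty E] (Γ : MetricGraph V E) (p : ℝ)
    (VD : Set V) : (Γ.rayleighQuotients p VD).Nonempty := by
  refine ⟨_, ⟨fun _ => 0, fun e x => x * (Γ.length e - x)⟩, fun e x => Γ.length e - 2 * x,
    IsContinuous.isSobolev_of_hasDerivAt ⟨fun e => by fun_prop, by simp, by simp⟩
      (fun e x _ => ?_) (fun e => by fun_prop) fun e => ⟨Γ.length e, fun x hx => ?_⟩,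
    fun _ _ => rfl, ?_, rfl⟩
  · refine ((hasDerivAt_id x).mul ((hasDerivAt_id x).const_sub (Γ.length e))).congr_deriv ?_
    simp only [id]
    ring
  · exact abs_le.2 ⟨by linarith [hx.2], by linarith [hx.1]⟩
  · obtain ⟨e⟩ := ‹Nonempty E›
    have := Γ.length_pos e
    exact ⟨e, Γ.length e / 2, ⟨by linarith, by linarith⟩,
      mul_ne_zero (by linarith) (by linarith)⟩

theorem Connected.le_firstEigenvalue [Fintype E] [Nonempty E] {p q : ℝ}
    (hpq : p.HolderConjugate q) (hΓ : Γ.Connected) {VD : Set V} (hVD : VD.Nonempty) :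
    (Real.pi / (q * Real.sin (Real.pi / q)) / Γ.totalLength) ^ p / (p - 1) ^ (p - 1) ≤
      Γ.firstEigenvalue p VD := by
  obtain ⟨v, hv⟩ := hVD
  refine le_csInf (Γ.rayleighQuotients_nonempty p VD) ?_
  rintro _ ⟨u, du, hu, hu0, hne, rfl⟩
  exact (le_div_iff₀ (hu.integralAbsPow_pos hpq.pos hne)).2
    (hu.integralAbsPow_le hpq hΓ (hu0 v hv))

theorem segment_connected {L : ℝ} (hL : 0 < L) : (segment L hL).Connected := by
  have h01 : (segment L hL).Adj 0 1 := ⟨(), Or.inl ⟨rfl, rfl⟩⟩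
  have h10 : (segment L hL).Adj 1 0 := ⟨(), Or.inr ⟨rfl, rfl⟩⟩
  refine ⟨⟨0⟩, fun v w => ?_⟩
  fin_cases v <;> fin_cases w
  · exact .refl
  · exact .single h01
  · exact .single h10
  · exact .refl

theorem segment_totalLength {L : ℝ} (hL : 0 < L) : (segment L hL).totalLength = L := by
  simp [totalLength, segment]

theorem segment_firstEigenvalue_le {p q L : ℝ} (hpq : p.HolderConjugate q) (hL : 0 < L) :
    (segment L hL).firstEigenvalue p {0} ≤
      (Real.pi / (q * Real.sin (Real.pi / q)) / L) ^ p / (p - 1) ^ (p - 1) := by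
  set A := Real.pi / (q * Real.sin (Real.pi / q)) with hA
  obtain ⟨S, g, hS, hS0, hSA, hd, hgc, ⟨C, hC⟩, hint⟩ := exists_generalized_sine hpq hA
  have hp0 := hpq.pos
  have hA0 : 0 < A := by
    have := sin_pi_div_pos hpq.symm.lt
    have := hpq.symm.pos
    positivity
  set k := A / L with hk
  have hk0 : 0 < k := by positivity
  have hkL : k * L = A := by rw [hk]; field_simp
  have hmaps : ∀ x ∈ Ioo 0 L, A - k * x ∈ Ioo 0 A := fun x hx =>
    ⟨by nlinarith [mul_lt_mul_of_pos_left hx.2 hk0], by nlinarith [mul_pos hk0 hx.1]⟩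
  -- The reflection puts the zero of S at the Dirichlet vertex and its value 1 at the free end.
  let u : GraphFunction (Fin 2) Unit := ⟨![0, 1], fun _ x => S (A - k * x)⟩
  let du : Unit → ℝ → ℝ := fun _ x => -k * g (A - k * x)
  have hlin : ∀ x, HasDerivAt (fun x => A - k * x) (-k) x := fun x => by
    simpa using ((hasDerivAt_id x).const_mul k).const_sub A
  have hcu : (segment L hL).IsContinuous u := by
    refine ⟨fun _ => ?_, fun _ => ?_, fun _ => ?_⟩
    · refine hS.comp (by fun_prop) fun x hx => ?_
      have hx' : x ∈ Icc 0 L := hx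
      exact ⟨by nlinarith [mul_le_mul_of_nonneg_left hx'.2 hk0.le],
        by nlinarith [mul_nonneg hk0.le hx'.1]⟩
    · simp [u, segment, hSA]
    · simp [u, segment, hkL, hS0]
  have hu : (segment L hL).IsSobolev p u du := by
    refine hcu.isSobolev_of_hasDerivAt (fun _ x hx => ?_) (fun _ => ?_) fun _ => ⟨k * C, ?_⟩
    · refine ((hd _ (hmaps x hx)).comp x (hlin x)).congr_deriv ?_
      simp only [du]
      ring
    · exact continuousOn_const.mul (hgc.comp (by fun_prop) fun x hx => hmaps x hx)
    · intro x hx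
      simp only [du, abs_mul, abs_neg, abs_of_pos hk0]
      exact mul_le_mul_of_nonneg_left (hC _ (hmaps x hx)) hk0.le
  have hne : (segment L hL).IsNonzero u :=
    ⟨(), L, ⟨hL.le, le_rfl⟩, by simp [u, hkL, hS0]⟩
  have hscale : ∀ F : ℝ → ℝ,
      ∫ x in Ioo 0 L, F (A - k * x) = k⁻¹ * ∫ t in Ioo 0 A, F t := fun F => by
    rw [← integral_Ioc_eq_integral_Ioo, ← intervalIntegral.integral_of_le hL.le,
      intervalIntegral.integral_comp_sub_mul F hk0.ne', hkL, sub_self, mul_zero, sub_zero,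
      intervalIntegral.integral_of_le hA0.le, integral_Ioc_eq_integral_Ioo, smul_eq_mul]
  have hD : (segment L hL).integralAbsPow p u.onEdge = k⁻¹ * ∫ t in Ioo 0 A, |S t| ^ p := by
    rw [← hscale fun t => |S t| ^ p]
    simp [integralAbsPow, segment, u]
  have hN : (segment L hL).integralAbsPow p du = k ^ p * (k⁻¹ * ∫ t in Ioo 0 A, |g t| ^ p) := by
    rw [← hscale fun t => |g t| ^ p, ← integral_const_mul]
    simp [integralAbsPow, segment, du, abs_mul, abs_of_pos hk0,
      Real.mul_rpow hk0.le (abs_nonneg _)]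
  have hDpos := hu.integralAbsPow_pos hp0 hne
  refine csInf_le ⟨0, ?_⟩ ⟨u, du, hu, ?_, hne, ?_⟩
  · rintro _ ⟨w, dw, -, -, -, rfl⟩
    exact div_nonneg (Finset.sum_nonneg fun e _ => integral_nonneg fun x => by positivity)
      (Finset.sum_nonneg fun e _ => integral_nonneg fun x => by positivity)
  · rintro v rfl
    rfl
  · rw [eq_div_iff hDpos.ne', hN, hD, ← hint]
    have : (p - 1) ^ (p - 1) ≠ 0 := (Real.rpow_pos_of_pos hpq.sub_one_pos _).ne'
    field_simp

end MetricGraph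

theorem mainTheorem1 (p p' : ℝ) (hp : 1 < p) (hp' : 1 / p + 1 / p' = 1) :
    (∀ (V : Type*) (E : Type*) [Finite V] [Fintype E] [Nonempty E] (Γ : MetricGraph V E)
        (VD : Set V), Γ.Connected → VD.Nonempty →
      (piP p / (2 * Γ.totalLength)) ^ p * (p / p') ≤ Γ.firstEigenvalue p VD) ∧
    (∀ (L : ℝ) (hL : 0 < L),
      (MetricGraph.segment L hL).Connected ∧ (MetricGraph.segment L hL).totalLength = L ∧
      (MetricGraph.segment L hL).firstEigenvalue p {0} = (piP p / (2 * L)) ^ p * (p / p')) := by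
  have hpq : p.HolderConjugate p' :=
    Real.holderConjugate_iff.2 ⟨hp, by simpa only [one_div] using hp'⟩
  refine ⟨fun V E _ _ _ Γ VD hΓ hVD => ?_, fun L hL => ?_⟩
  · rw [piP_div_rpow_mul hpq Γ.totalLength_pos]
    exact hΓ.le_firstEigenvalue hpq hVD
  · refine ⟨MetricGraph.segment_connected hL, MetricGraph.segment_totalLength hL, ?_⟩
    rw [piP_div_rpow_mul hpq hL]
    refine le_antisymm (MetricGraph.segment_firstEigenvalue_le hpq hL) ?_
    have := (MetricGraph.segment_connected hL).le_firstEigenvalue hpq (singleton_nonempty 0)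
    rwa [MetricGraph.segment_totalLength] at this
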